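/- Let $\ell_p$ denote the usual spaces of real sequences $(x_k)_{k\ge 1}$. For $x\in\ell_2$ and $s>0$ put $$K_{1,2}(x,s)=\inf\{\|x'\|_1+s\|x''\|_2 : x',x''\in\ell_2,\ x'+x''=x\}.$$ Call $c>0$ a tail constant if, for independent Rademacher variables $\epsilon_1,\epsilon_2,\dots$ (each equal to $\pm1$ with probability $1/2$), $$P\Big(\sum_{k\ge1}x_k\epsilon_k\ge c^{-1}K_{1,2}(x,s)\Big)\ge c^{-1}e^{-cs^2}\qquad\text{for all }x\in\ell_2,\ s>0. \tag{1}$$ A tail constant exists (Montgomery-Smith). Moreover, for every tail constant $c>0$ the following holds. Let $B$ be a real topological vector space whose topology is given by a complete, separable, translation-invariant metric, let $X$ be a $B$-valued Borel random vector with law $\mu$, and let $t_k:B\to\mathbb{R}$, $k\ge1$, be Borel measurable functions (not necessarily linear or continuous) such that $\{t_k(X):k\ge1\}$ are independent Rademacher random variables. Let $\mathcal T$ be the set of all finite linear combinations of the functions $t_k$, and for $a\in B$ let $$HD_{\mathcal T}(a,\mu)=\inf_{t\in\mathcal T}\mu(\{x\in B: t(x)\ge t(a)\}).$$ If $a\in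 B$ satisfies $\sum_{k\ge1}t_k(a)^2<\infty$ and, for some $t_0>0$, $$\max\Big\{c\,\|(t_k(a))_{k\ge1}\|_\infty,\ t_0^{-1}c\,\|(t_k(a))_{k\ge1}\|_2\Big\}\le 1,$$ then $$HD_{\mathcal T}(a,\mu)\ge c^{-1}e^{-ct_0^2}.$$ -/

import Mathlib

open MeasureTheory ProbabilityTheory Filter Topology
open scoped ENNReal

noncomputable section

/-- The half space depth of `a : B` with respect to a collection `T` of functionals on `B` and a
measure `μ` on `B`: the infimum over `t ∈ T` of `μ {x | t x ≥ t a}`. -/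
def halfSpaceDepth {B : Type*} [MeasurableSpace B] (T : Set (B → ℝ)) (a : B) (μ : Measure B) : ℝ :=
  ⨅ t : T, μ.real {x | t.1 x ≥ t.1 a}

/-- The law of a Rademacher random variable: mass `1/2` at each of `1` and `-1`. -/
def rademacherLaw : Measure ℝ :=
  (2⁻¹ : ℝ≥0∞) • Measure.dirac 1 + (2⁻¹ : ℝ≥0∞) • Measure.dirac (-1)

instance isProbabilityMeasure_rademacherLaw : IsProbabilityMeasure rademacherLaw := by
  constructor
  simp [rademacherLaw, ENNReal.inv_two_add_inv_two]

/-- The joint law, on `ℝ^ℕ`, of a sequence of independent Rademacher random variables. -/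
def rademacherSeqLaw : Measure (ℕ → ℝ) := Measure.infinitePi fun _ => rademacherLaw

/-- The K-functional of the pair `(ℓ₁, ℓ₂)`: for `x ∈ ℓ₂` and `s > 0`, the infimum of
`‖x'‖₁ + s * ‖x''‖₂` over all decompositions `x = x' + x''` in `ℓ₂`. Decompositions with
`‖x'‖₁ = ∞` do not affect the infimum and are left out. -/
def kFunctional (x : lp (fun _ : ℕ => ℝ) 2) (s : ℝ) : ℝ :=
  sInf {r : ℝ | ∃ x' x'' : lp (fun _ : ℕ => ℝ) 2,
    x' + x'' = x ∧ Summable (fun k => |x' k|) ∧ r = (∑' k, |x' k|) + s * ‖x''‖}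

/-- `c` is a constant for which the lower tail bound
`P (∑ x_k ε_k ≥ c⁻¹ K(x, s)) ≥ c⁻¹ exp (-c s²)` holds for all `x ∈ ℓ₂` and all `s > 0`, where
`ε_0, ε_1, …` are independent Rademacher variables. The random series is the limit of its partial
sums (it converges almost surely, in general not absolutely). -/
def IsRademacherTailConstant (c : ℝ) : Prop :=
  ∀ (x : lp (fun _ : ℕ => ℝ) 2) (s : ℝ), 0 < s →
    c⁻¹ * Real.exp (-c * s ^ 2) ≤
      rademacherSeqLaw.real {ε | ∃ S : ℝ,
        Tendsto (fun n => ∑ k ∈ Finset.range n, x k * ε k) atTop (𝓝 S) ∧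
          S ≥ c⁻¹ * kFunctional x s}

end

/-!
By Hahn–Banach, the K-functional is dual to the norm `max (‖y‖_∞) (‖y‖₂ / s)`: one has
`⟨x, y⟩ ≤ K(x, s)` as soon as `‖y‖_∞ ≤ 1` and `‖y‖₂ ≤ s`, with equality for some such `y`.

For the existence of a tail constant, take this optimal `y` and cut the index set into at most
about `s²` blocks on each of which `∑ y_k²` is of order `1`. On a block `C`, Paley–Zygmund for the
square of `∑ x_k ε_k` and the symmetry of its law bound below, by a universal constant, the
probability that this sum is at least half of `(∑_C x_k²)^{1/2}`, which by Cauchy–Schwarz dominates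
`∑_C x_k y_k` up to a constant. The blocks are independent, so with probability at least
`e^{-3(1 + s²)}` all these inequalities hold at once and add up to a multiple of `⟨x, y⟩`, that is,
of `K(x, s)`.

For the depth, the condition on `a` says that `c (t_k(a))_k` satisfies the two constraints on `y`
with `s = t₀`, so `∑ x_k t_k(a) ≤ c⁻¹ K(x, t₀)` for every finite combination `∑ x_k t_k`, and the
tail bound applies to `∑ x_k t_k(X)`.
-/

open scoped lp

/-! ### Duality for the K-functional -/

section SublinearFunctional

variable {E : Type*} [AddCommGroup E] [Module ℝ E]

lemma exists_linearMap_eq_and_le_of_sublinear {N : E → ℝ}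
    (hsmul : ∀ c : ℝ, 0 < c → ∀ x, N (c • x) = c * N x) (hadd : ∀ x y, N (x + y) ≤ N x + N y)
    (hnonneg : ∀ x, 0 ≤ N x) (x : E) : ∃ g : E →ₗ[ℝ] ℝ, g x = N x ∧ ∀ z, g z ≤ N z := by
  have hzero : N 0 = 0 := by
    have := hsmul 2 two_pos 0
    rw [smul_zero] at this
    linarith
  rcases eq_or_ne x 0 with rfl | hx
  · exact ⟨0, by simp [hzero], hnonneg⟩
  let f : E →ₗ.[ℝ] ℝ := LinearPMap.mkSpanSingleton x (N x) hx
  have hf : ∀ z : f.domain, f z ≤ N z := by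
    rintro ⟨z, hz⟩
    obtain ⟨c, rfl⟩ := Submodule.mem_span_singleton.1 hz
    rw [LinearPMap.mkSpanSingleton'_apply, RingHom.id_apply, smul_eq_mul]
    rcases le_or_gt c 0 with hc | hc
    · exact (mul_nonpos_of_nonpos_of_nonneg hc (hnonneg x)).trans (hnonneg _)
    · exact (hsmul c hc x).ge
  obtain ⟨g, hgf, hgN⟩ := exists_extension_of_le_sublinear f N hsmul hadd hf
  refine ⟨g, ?_, hgN⟩
  have := hgf ⟨x, Submodule.mem_span_singleton_self x⟩
  rwa [LinearPMap.mkSpanSingleton_apply] at this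

end SublinearFunctional

section KFunctional

variable {x y x' x'' : ℓ²(ℕ, ℝ)} {s : ℝ}

lemma hasSum_sq_lp_two (x : ℓ²(ℕ, ℝ)) : HasSum (fun k => x k ^ 2) (‖x‖ ^ 2) := by
  simpa using lp.hasSum_norm (p := 2) (by norm_num) x

lemma hasSum_mul_lp_two (x y : ℓ²(ℕ, ℝ)) : HasSum (fun k => x k * y k) (inner ℝ x y) := by
  simpa [mul_comm] using lp.hasSum_inner (𝕜 := ℝ) x y

lemma exists_lp_two_eq_of_summable_sq {u : ℕ → ℝ} (hu : Summable fun k => u k ^ 2) :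
    ∃ y : ℓ²(ℕ, ℝ), ∀ k, y k = u k :=
  ⟨⟨u, memℓp_gen (by simpa using hu)⟩, fun _ => rfl⟩

lemma norm_lp_two_eq_sqrt_tsum (y : ℓ²(ℕ, ℝ)) : ‖y‖ = √(∑' k, y k ^ 2) := by
  rw [(hasSum_sq_lp_two y).tsum_eq, Real.sqrt_sq (norm_nonneg y)]

lemma bddAbove_range_abs_lp_two (y : ℓ²(ℕ, ℝ)) : BddAbove (Set.range fun k => |y k|) :=
  ⟨‖y‖, Set.forall_mem_range.2 (lp.norm_apply_le_norm two_ne_zero y)⟩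

lemma kFunctional_le (hs : 0 ≤ s) (hadd : x' + x'' = x) (hx' : Summable fun k => |x' k|) :
    kFunctional x s ≤ (∑' k, |x' k|) + s * ‖x''‖ := by
  refine csInf_le ⟨0, ?_⟩ ⟨x', x'', hadd, hx', rfl⟩
  rintro _ ⟨u, v, -, -, rfl⟩
  positivity

lemma le_kFunctional {b : ℝ} (hb : ∀ x' x'' : ℓ²(ℕ, ℝ), x' + x'' = x →
    Summable (fun k => |x' k|) → b ≤ (∑' k, |x' k|) + s * ‖x''‖) : b ≤ kFunctional x s := by
  refine le_csInf ⟨_, 0, x, zero_add x, by simp [summable_zero], rfl⟩ ?_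
  rintro _ ⟨x', x'', hadd, hx', rfl⟩
  exact hb x' x'' hadd hx'

lemma kFunctional_nonneg (hs : 0 ≤ s) (x : ℓ²(ℕ, ℝ)) : 0 ≤ kFunctional x s :=
  le_kFunctional fun _ _ _ _ => by positivity

lemma kFunctional_le_mul_norm (hs : 0 ≤ s) (x : ℓ²(ℕ, ℝ)) : kFunctional x s ≤ s * ‖x‖ := by
  simpa using kFunctional_le hs (zero_add x) (by simp [summable_zero])

lemma kFunctional_single_le (hs : 0 ≤ s) (k : ℕ) (r : ℝ) :
    kFunctional (lp.single 2 k r) s ≤ |r| := by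
  have hsum : HasSum (fun j => |(lp.single 2 k r : ℓ²(ℕ, ℝ)) j|) |r| := by
    have h := hasSum_single (f := fun j => |(lp.single 2 k r : ℓ²(ℕ, ℝ)) j|) k
      fun j hj => by rw [lp.single_apply_ne _ _ _ hj, abs_zero]
    rwa [lp.single_apply_self] at h
  refine (kFunctional_le hs (add_zero _) hsum.summable).trans_eq ?_
  rw [hsum.tsum_eq, norm_zero, mul_zero, add_zero]

lemma kFunctional_add_le (hs : 0 ≤ s) (x y : ℓ²(ℕ, ℝ)) :
    kFunctional (x + y) s ≤ kFunctional x s + kFunctional y s := by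
  rw [← sub_le_iff_le_add]
  refine le_kFunctional fun x' x'' hx hx' => ?_
  rw [sub_le_comm]
  refine le_kFunctional fun y' y'' hy hy' => ?_
  rw [sub_le_iff_le_add]
  have hle : ∀ k, |(x' + y') k| ≤ |x' k| + |y' k| := fun k => abs_add_le _ _
  have hsum : Summable fun k => |(x' + y') k| :=
    (hx'.add hy').of_nonneg_of_le (fun k => abs_nonneg _) hle
  calc kFunctional (x + y) s
      ≤ (∑' k, |(x' + y') k|) + s * ‖x'' + y''‖ :=
        kFunctional_le hs (by rw [← hx, ← hy]; abel) hsum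
    _ ≤ ((∑' k, |x' k|) + ∑' k, |y' k|) + s * (‖x''‖ + ‖y''‖) := by
        gcongr
        · rw [← hx'.tsum_add hy']
          exact hsum.tsum_le_tsum hle (hx'.add hy')
        · exact norm_add_le _ _
    _ = (∑' k, |y' k|) + s * ‖y''‖ + ((∑' k, |x' k|) + s * ‖x''‖) := by ring

lemma kFunctional_smul_le (hs : 0 ≤ s) {c : ℝ} (hc : 0 < c) (x : ℓ²(ℕ, ℝ)) :
    kFunctional (c • x) s ≤ c * kFunctional x s := by
  rw [← div_le_iff₀' hc]
  refine le_kFunctional fun x' x'' hx hx' => ?_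
  rw [div_le_iff₀' hc]
  have habs : ∀ k, |(c • x') k| = c * |x' k| := fun k => by
    rw [lp.coeFn_smul, Pi.smul_apply, smul_eq_mul, abs_mul, abs_of_pos hc]
  have hsum : Summable fun k => |(c • x') k| := by simpa only [habs] using hx'.mul_left c
  refine (kFunctional_le hs (by rw [← hx, smul_add]) hsum).trans_eq ?_
  rw [tsum_congr habs, tsum_mul_left, norm_smul, Real.norm_of_nonneg hc.le]
  ring

lemma kFunctional_smul (hs : 0 ≤ s) {c : ℝ} (hc : 0 < c) (x : ℓ²(ℕ, ℝ)) :
    kFunctional (c • x) s = c * kFunctional x s := by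
  refine (kFunctional_smul_le hs hc x).antisymm ?_
  simpa [smul_smul, hc.ne', le_inv_mul_iff₀ hc] using
    kFunctional_smul_le hs (inv_pos.2 hc) (c • x)

lemma inner_le_kFunctional (hy_sup : ∀ k, |y k| ≤ 1) (hy_norm : ‖y‖ ≤ s) :
    inner ℝ x y ≤ kFunctional x s := by
  refine le_kFunctional fun x' x'' hx hx' => ?_
  rw [← hx, inner_add_left]
  have hle : ∀ k, x' k * y k ≤ |x' k| := fun k => by
    calc x' k * y k ≤ |x' k| * |y k| := (le_abs_self _).trans_eq (abs_mul _ _)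
      _ ≤ |x' k| := mul_le_of_le_one_right (abs_nonneg _) (hy_sup k)
  refine add_le_add (hasSum_le hle (hasSum_mul_lp_two x' y) hx'.hasSum) ?_
  calc inner ℝ x'' y ≤ ‖x''‖ * ‖y‖ := real_inner_le_norm _ _
    _ ≤ s * ‖x''‖ := by rw [mul_comm]; gcongr

lemma exists_inner_eq_kFunctional (hs : 0 ≤ s) (x : ℓ²(ℕ, ℝ)) :
    ∃ y : ℓ²(ℕ, ℝ), (∀ k, |y k| ≤ 1) ∧ ‖y‖ ≤ s ∧ inner ℝ x y = kFunctional x s := by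
  obtain ⟨g, hgx, hgK⟩ := exists_linearMap_eq_and_le_of_sublinear
    (N := fun z => kFunctional z s) (fun c hc => kFunctional_smul hs hc)
    (kFunctional_add_le hs) (kFunctional_nonneg hs) x
  have hg_norm : ∀ z, ‖g z‖ ≤ s * ‖z‖ := fun z => by
    refine abs_le'.2 ⟨(hgK z).trans (kFunctional_le_mul_norm hs z), ?_⟩
    rw [← map_neg, ← norm_neg z]
    exact (hgK _).trans (kFunctional_le_mul_norm hs _)
  let y : ℓ²(ℕ, ℝ) := (InnerProductSpace.toDual ℝ ℓ²(ℕ, ℝ)).symm (g.mkContinuous s hg_norm)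
  have hy : ∀ z, inner ℝ z y = g z := fun z => by
    rw [real_inner_comm]
    exact InnerProductSpace.toDual_symm_apply
  have hy_mul_le : ∀ k r, r * y k ≤ |r| := fun k r => by
    have h : inner ℝ (lp.single 2 k r) y = r * y k := by
      rw [lp.inner_single_left]
      exact mul_comm _ _
    rw [← h, hy]
    exact (hgK _).trans (kFunctional_single_le hs k r)
  refine ⟨y, fun k => abs_le'.2 ⟨?_, ?_⟩, ?_, (hy x).trans hgx⟩
  · simpa using hy_mul_le k 1
  · simpa using hy_mul_le k (-1)
  · rw [LinearIsometryEquiv.norm_map]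
    exact g.mkContinuous_norm_le hs hg_norm

end KFunctional

/-! ### Second and fourth moments -/

section Moments

variable {Ω : Type*} [MeasurableSpace Ω] {P : Measure Ω} {X Y : Ω → ℝ}

lemma integrable_pow_of_memLp [IsFiniteMeasure P] {m n : ℕ} (hX : MemLp X n P) (hmn : m ≤ n) :
    Integrable (fun ω => X ω ^ m) P := by
  have h : MemLp X m P := hX.mono_exponent (by exact_mod_cast hmn)
  rw [← integrable_norm_iff (by have := hX.aestronglyMeasurable; fun_prop)]
  simpa only [norm_pow] using h.integrable_norm_pow'

lemma sq_integral_le_measureReal_univ_mul [IsFiniteMeasure P] (hX : MemLp X 2 P) :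
    (∫ ω, X ω ∂P) ^ 2 ≤ P.real Set.univ * ∫ ω, X ω ^ 2 ∂P := by
  have hX1 : Integrable X P := hX.integrable one_le_two
  have hquad : ∀ r : ℝ,
      0 ≤ P.real Set.univ * (r * r) + (-2 * ∫ ω, X ω ∂P) * r + ∫ ω, X ω ^ 2 ∂P := fun r =>
    calc 0 ≤ ∫ ω, (X ω - r) ^ 2 ∂P := integral_nonneg fun ω => sq_nonneg _
      _ = ∫ ω, (X ω ^ 2 - 2 * r * X ω + r ^ 2) ∂P := by congr with ω; ring
      _ = ∫ ω, X ω ^ 2 ∂P - 2 * r * ∫ ω, X ω ∂P + P.real Set.univ * r ^ 2 := by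
        have hlin : Integrable (fun ω => 2 * r * X ω) P := hX1.const_mul _
        rw [integral_add (hX.integrable_sq.sub' hlin) (integrable_const _),
          integral_sub hX.integrable_sq hlin, integral_const_mul, integral_const, smul_eq_mul]
      _ = _ := by ring
  have hdiscrim := discrim_le_zero hquad
  rw [discrim] at hdiscrim
  linarith

lemma eLpNorm_one_le_sqrt_variance [IsProbabilityMeasure P] (hX : MemLp X 2 P)
    (hX₀ : ∫ ω, X ω ∂P = 0) : eLpNorm X 1 P ≤ ENNReal.ofReal √Var[X; P] := by
  rw [eLpNorm_one_eq_lintegral_enorm,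
    ← ofReal_integral_norm_eq_lintegral_enorm (hX.integrable one_le_two),
    variance_of_integral_eq_zero hX.1.aemeasurable hX₀]
  refine ENNReal.ofReal_le_ofReal (Real.le_sqrt_of_sq_le ?_)
  simpa using sq_integral_le_measureReal_univ_mul hX.norm

lemma paley_zygmund [IsProbabilityMeasure P] (hX : MemLp X 2 P) (hnonneg : 0 ≤ᵐ[P] X) {θ : ℝ}
    (hθ₀ : 0 ≤ θ) (hθ₁ : θ ≤ 1) :
    (1 - θ) ^ 2 * (∫ ω, X ω ∂P) ^ 2 ≤
      (∫ ω, X ω ^ 2 ∂P) * P.real {ω | θ * ∫ ω, X ω ∂P ≤ X ω} := by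
  set m := ∫ ω, X ω ∂P
  set A := {ω | θ * m ≤ X ω}
  have hm : 0 ≤ m := integral_nonneg_of_ae hnonneg
  have hA : NullMeasurableSet A P :=
    nullMeasurableSet_le aemeasurable_const hX.1.aemeasurable
  have hX1 : Integrable X P := hX.integrable one_le_two
  have hcompl : ∫ ω in Aᶜ, X ω ∂P ≤ θ * m :=
    calc ∫ ω in Aᶜ, X ω ∂P
        ≤ ∫ _ in Aᶜ, θ * m ∂P :=
          setIntegral_mono_on₀ hX1.integrableOn (integrable_const _) hA.compl
            fun ω (hω : ¬θ * m ≤ X ω) => (not_le.1 hω).le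
      _ = P.real Aᶜ * (θ * m) := by rw [setIntegral_const, smul_eq_mul]
      _ ≤ θ * m := mul_le_of_le_one_left (by positivity) measureReal_le_one
  have hlower : (1 - θ) * m ≤ ∫ ω in A, X ω ∂P := by
    linarith [integral_add_compl₀ hA hX1]
  calc (1 - θ) ^ 2 * m ^ 2 = ((1 - θ) * m) ^ 2 := by ring
    _ ≤ (∫ ω in A, X ω ∂P) ^ 2 :=
      pow_le_pow_left₀ (mul_nonneg (sub_nonneg.2 hθ₁) hm) hlower 2
    _ ≤ P.real A * ∫ ω in A, X ω ^ 2 ∂P := by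
      simpa using sq_integral_le_measureReal_univ_mul (hX.restrict A)
    _ ≤ P.real A * ∫ ω, X ω ^ 2 ∂P := by
      gcongr
      exacts [ae_of_all _ fun ω => sq_nonneg _, hX.integrable_sq, Measure.restrict_le_self]
    _ = _ := mul_comm _ _

lemma integral_eq_zero_of_identDistrib_neg (hX : IdentDistrib X (-X) P P) :
    ∫ ω, X ω ∂P = 0 := by
  have h := hX.integral_eq
  simp only [Pi.neg_apply, integral_neg] at h
  linarith

lemma measureReal_sq_le_sq_le_two_mul [IsFiniteMeasure P] (hX : IdentDistrib X (-X) P P) (r : ℝ) :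
    P.real {ω | r ^ 2 ≤ X ω ^ 2} ≤ 2 * P.real {ω | r ≤ X ω} := by
  have hneg : P.real {ω | r ≤ -X ω} = P.real {ω | r ≤ X ω} :=
    (congrArg ENNReal.toReal (hX.measure_mem_eq measurableSet_Ici)).symm
  have hsub : {ω | r ^ 2 ≤ X ω ^ 2} ⊆ {ω | r ≤ X ω} ∪ {ω | r ≤ -X ω} :=
    fun ω (hω : r ^ 2 ≤ X ω ^ 2) => le_abs.1 ((le_abs_self r).trans (sq_le_sq.1 hω))
  calc P.real {ω | r ^ 2 ≤ X ω ^ 2} ≤ P.real {ω | r ≤ X ω} + P.real {ω | r ≤ -X ω} :=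
        (measureReal_mono hsub).trans (measureReal_union_le _ _)
    _ = 2 * P.real {ω | r ≤ X ω} := by rw [hneg, two_mul]

lemma le_mul_measureReal_mul_variance_le_sq [IsProbabilityMeasure P] (hX : MemLp X 4 P)
    (hX₀ : ∫ ω, X ω ∂P = 0) {K : ℝ} (hK : 1 ≤ K) (hkurt : ∫ ω, X ω ^ 4 ∂P ≤ K * Var[X; P] ^ 2)
    {θ : ℝ} (hθ₀ : 0 ≤ θ) (hθ₁ : θ ≤ 1) :
    (1 - θ) ^ 2 ≤ K * P.real {ω | θ * Var[X; P] ≤ X ω ^ 2} := by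
  have hvar : Var[X; P] = ∫ ω, X ω ^ 2 ∂P := variance_of_integral_eq_zero hX.1.aemeasurable hX₀
  rcases (variance_nonneg X P).eq_or_lt with h0 | hpos
  · have huniv : {ω | θ * Var[X; P] ≤ X ω ^ 2} = Set.univ :=
      Set.eq_univ_of_forall fun ω => by simp [← h0, sq_nonneg]
    rw [huniv, probReal_univ]
    nlinarith
  · have hX2 : MemLp (fun ω => X ω ^ 2) 2 P :=
      (memLp_two_iff_integrable_sq (hX.1.pow 2)).2 <| by
        simpa only [Pi.pow_apply, ← pow_mul] using integrable_pow_of_memLp (n := 4) hX le_rfl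
    have hpz := paley_zygmund hX2 (ae_of_all _ fun ω => sq_nonneg (X ω)) hθ₀ hθ₁
    simp only [← hvar, ← pow_mul] at hpz
    refine le_of_mul_le_mul_right (hpz.trans ?_) (pow_pos hpos 2)
    calc _ ≤ K * Var[X; P] ^ 2 * P.real {ω | θ * Var[X; P] ≤ X ω ^ 2} := by gcongr
      _ = _ := by ring

lemma le_measureReal_mul_sqrt_variance_le [IsProbabilityMeasure P] (hX : MemLp X 4 P)
    (hsymm : IdentDistrib X (-X) P P) {K : ℝ} (hK : 1 ≤ K)
    (hkurt : ∫ ω, X ω ^ 4 ∂P ≤ K * Var[X; P] ^ 2) {θ : ℝ} (hθ₀ : 0 ≤ θ) (hθ₁ : θ ≤ 1) :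
    (1 - θ ^ 2) ^ 2 ≤ 2 * K * P.real {ω | θ * √Var[X; P] ≤ X ω} := by
  have hX₀ := integral_eq_zero_of_identDistrib_neg hsymm
  calc (1 - θ ^ 2) ^ 2 ≤ K * P.real {ω | θ ^ 2 * Var[X; P] ≤ X ω ^ 2} :=
        le_mul_measureReal_mul_variance_le_sq hX hX₀ hK hkurt (sq_nonneg θ)
          (pow_le_one₀ hθ₀ hθ₁)
    _ = K * P.real {ω | (θ * √Var[X; P]) ^ 2 ≤ X ω ^ 2} := by
        rw [mul_pow, Real.sq_sqrt (variance_nonneg X P)]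
    _ ≤ K * (2 * P.real {ω | θ * √Var[X; P] ≤ X ω}) := by
        gcongr
        exact measureReal_sq_le_sq_le_two_mul hsymm _
    _ = 2 * K * P.real {ω | θ * √Var[X; P] ≤ X ω} := by ring

lemma integral_add_pow_four [IsProbabilityMeasure P] (hX : MemLp X 4 P) (hY : MemLp Y 4 P)
    (hXY : IndepFun X Y P) (hX₀ : ∫ ω, X ω ∂P = 0) (hY₀ : ∫ ω, Y ω ∂P = 0) :
    ∫ ω, (X ω + Y ω) ^ 4 ∂P =
      ∫ ω, X ω ^ 4 ∂P + 6 * (Var[X; P] * Var[Y; P]) + ∫ ω, Y ω ^ 4 ∂P := by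
  have hXm := hX.1.aemeasurable
  have hYm := hY.1.aemeasurable
  have hXi : ∀ m ≤ 4, Integrable (fun ω => X ω ^ m) P := fun m => integrable_pow_of_memLp hX
  have hYi : ∀ m ≤ 4, Integrable (fun ω => Y ω ^ m) P := fun m => integrable_pow_of_memLp hY
  have hind : ∀ i j : ℕ, IndepFun (fun ω => X ω ^ i) (fun ω => Y ω ^ j) P := fun i j =>
    hXY.comp (measurable_id.pow_const i) (measurable_id.pow_const j)
  have hint : ∀ i ≤ 4, ∀ j ≤ 4, Integrable (fun ω => X ω ^ i * Y ω ^ j) P := fun i hi j hj =>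
    (hind i j).integrable_mul (hXi i hi) (hYi j hj)
  have hmul : ∀ i j,
      ∫ ω, X ω ^ i * Y ω ^ j ∂P = (∫ ω, X ω ^ i ∂P) * ∫ ω, Y ω ^ j ∂P := fun i j =>
    (hind i j).integral_fun_mul_eq_mul_integral (hX.1.pow i) (hY.1.pow j)
  simp only [add_pow]
  rw [integral_finsetSum]
  · simp only [integral_mul_const, hmul]
    rw [variance_of_integral_eq_zero hXm hX₀, variance_of_integral_eq_zero hYm hY₀]
    simp [Finset.sum_range_succ, hX₀, hY₀, Nat.choose]
    ring
  · intro i hi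
    exact (hint i (Finset.mem_range_succ_iff.1 hi) (4 - i) (Nat.sub_le _ _)).mul_const _

end Moments

/-! ### Sums of independent variables -/

section IndependentSums

variable {Ω ι : Type*} [MeasurableSpace Ω] {P : Measure Ω} {X : ι → Ω → ℝ}

lemma indepFun_sum_sum_of_disjoint (hX : iIndepFun X P) (hmeas : ∀ k, AEMeasurable (X k) P)
    {A C : Finset ι} (hAC : Disjoint A C) :
    IndepFun (∑ k ∈ A, X k) (∑ k ∈ C, X k) P := by
  have hsum : ∀ D : Finset ι,
      ∑ k ∈ D, X k = (fun u : D → ℝ => ∑ k, u k) ∘ fun ω (k : D) => X k ω := fun D => by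
    ext ω
    simpa using (Finset.sum_coe_sort D fun k => X k ω).symm
  rw [hsum A, hsum C]
  exact (hX.indepFun_finset₀ A C hAC hmeas).comp (by fun_prop) (by fun_prop)

lemma measureReal_le_sum_mul_le_of_disjoint [DecidableEq ι] (hX : iIndepFun X P)
    (hmeas : ∀ k, AEMeasurable (X k) P) {A C : Finset ι} (hAC : Disjoint A C) (α β : ℝ) :
    P.real {ω | α ≤ ∑ k ∈ A, X k ω} * P.real {ω | β ≤ ∑ k ∈ C, X k ω} ≤
      P.real {ω | α + β ≤ ∑ k ∈ A ∪ C, X k ω} := by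
  have := hX.isProbabilityMeasure
  have hind := congrArg ENNReal.toReal <|
    (indepFun_sum_sum_of_disjoint hX hmeas hAC).measure_inter_preimage_eq_mul
      (Set.Ici α) (Set.Ici β) measurableSet_Ici measurableSet_Ici
  simp only [ENNReal.toReal_mul, Set.preimage, Set.mem_Ici, Finset.sum_apply] at hind
  refine hind.symm.le.trans (measureReal_mono fun ω ⟨hα, hβ⟩ => ?_)
  rw [Set.mem_ofPred_eq] at hα hβ ⊢
  rw [Finset.sum_union hAC]
  exact add_le_add hα hβ

lemma identDistrib_neg_sum (hX : iIndepFun X P) (hsymm : ∀ k, IdentDistrib (X k) (-X k) P P)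
    (A : Finset ι) : IdentDistrib (∑ k ∈ A, X k) (-∑ k ∈ A, X k) P P := by
  have hXA : iIndepFun (fun k : A => X k) P := hX.precomp Subtype.val_injective
  have hnegA : iIndepFun (fun k : A => -X k) P :=
    hXA.comp (fun _ => Neg.neg) fun _ => measurable_neg
  have hsum : Measurable fun u : A → ℝ => ∑ k, u k := by fun_prop
  convert (IdentDistrib.pi (fun k : A => hsymm k) hXA hnegA).comp hsum using 1
  · ext ω
    simpa using (Finset.sum_coe_sort A fun k => X k ω).symm
  · ext ω
    simpa using (Finset.sum_coe_sort A fun k => X k ω).symm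

lemma integral_sum_eq_zero (hint : ∀ k, Integrable (X k) P) (hX₀ : ∀ k, ∫ ω, X k ω ∂P = 0)
    (A : Finset ι) : ∫ ω, (∑ k ∈ A, X k) ω ∂P = 0 := by
  simp only [Finset.sum_apply]
  rw [integral_finsetSum _ fun k _ => hint k]
  exact Finset.sum_eq_zero fun k _ => hX₀ k

lemma integral_sum_pow_four_le (hX : iIndepFun X P) (h4 : ∀ k, MemLp (X k) 4 P)
    (hX₀ : ∀ k, ∫ ω, X k ω ∂P = 0) {K : ℝ} (hK : 3 ≤ K)
    (hkurt : ∀ k, ∫ ω, X k ω ^ 4 ∂P ≤ K * Var[X k; P] ^ 2) (A : Finset ι) :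
    ∫ ω, (∑ k ∈ A, X k) ω ^ 4 ∂P ≤ K * Var[∑ k ∈ A, X k; P] ^ 2 := by
  classical
  have := hX.isProbabilityMeasure
  have h2 : ∀ k, MemLp (X k) 2 P := fun k => (h4 k).mono_exponent (by norm_num)
  have h1 : ∀ k, Integrable (X k) P := fun k => (h2 k).integrable one_le_two
  induction A using Finset.induction_on with
  | empty => simp
  | insert i A hi ih =>
    have hind : IndepFun (X i) (∑ k ∈ A, X k) P := by
      simpa using indepFun_sum_sum_of_disjoint hX (fun k => (h1 k).1.aemeasurable)
        (Finset.disjoint_singleton_left.2 hi)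
    rw [Finset.sum_insert hi, hind.variance_add (h2 i) (memLp_finsetSum' A fun k _ => h2 k)]
    calc ∫ ω, (X i + ∑ k ∈ A, X k) ω ^ 4 ∂P
        = ∫ ω, X i ω ^ 4 ∂P + 6 * (Var[X i; P] * Var[∑ k ∈ A, X k; P]) +
            ∫ ω, (∑ k ∈ A, X k) ω ^ 4 ∂P :=
          integral_add_pow_four (h4 i) (memLp_finsetSum' A fun k _ => h4 k) hind (hX₀ i)
            (integral_sum_eq_zero h1 hX₀ A)
      _ ≤ K * Var[X i; P] ^ 2 + 2 * K * (Var[X i; P] * Var[∑ k ∈ A, X k; P]) +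
            K * Var[∑ k ∈ A, X k; P] ^ 2 := by
          have := mul_nonneg (variance_nonneg (X i) P) (variance_nonneg (∑ k ∈ A, X k) P)
          gcongr
          · exact hkurt i
          · linarith
      _ = K * (Var[X i; P] + Var[∑ k ∈ A, X k; P]) ^ 2 := by ring

lemma le_measureReal_mul_sqrt_sum_variance_le (hX : iIndepFun X P) (h4 : ∀ k, MemLp (X k) 4 P)
    (hsymm : ∀ k, IdentDistrib (X k) (-X k) P P) {K : ℝ} (hK : 3 ≤ K)
    (hkurt : ∀ k, ∫ ω, X k ω ^ 4 ∂P ≤ K * Var[X k; P] ^ 2) {θ : ℝ} (hθ₀ : 0 ≤ θ) (hθ₁ : θ ≤ 1)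
    (A : Finset ι) :
    (1 - θ ^ 2) ^ 2 ≤ 2 * K * P.real {ω | θ * √(∑ k ∈ A, Var[X k; P]) ≤ ∑ k ∈ A, X k ω} := by
  have := hX.isProbabilityMeasure
  have hvar : Var[∑ k ∈ A, X k; P] = ∑ k ∈ A, Var[X k; P] :=
    IndepFun.variance_sum (fun k _ => (h4 k).mono_exponent (by norm_num))
      fun i _ j _ hij => hX.indepFun hij
  have h := le_measureReal_mul_sqrt_variance_le (memLp_finsetSum' A fun k _ => h4 k)
    (identDistrib_neg_sum hX hsymm A) (by linarith : 1 ≤ K)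
    (integral_sum_pow_four_le hX h4 (fun k => integral_eq_zero_of_identDistrib_neg (hsymm k)) hK
      hkurt A) hθ₀ hθ₁
  simpa only [hvar, Finset.sum_apply] using h

end IndependentSums

section Convergence

variable {Ω : Type*} [MeasurableSpace Ω] {P : Measure Ω} {X : ℕ → Ω → ℝ}

lemma martingale_sum_range_succ (hX : iIndepFun X P) (hmeas : ∀ k, StronglyMeasurable (X k))
    (hint : ∀ k, Integrable (X k) P) (hX₀ : ∀ k, ∫ ω, X k ω ∂P = 0) :
    Martingale (fun n => ∑ k ∈ Finset.range (n + 1), X k) (Filtration.natural X hmeas) P := by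
  have := hX.isProbabilityMeasure
  refine martingale_of_condExp_sub_eq_zero_nat (fun n => ?_)
    (fun n => integrable_finsetSum' _ fun k _ => hint k) fun n => ?_
  · exact Finset.stronglyMeasurable_sum _ fun k hk =>
      (Filtration.stronglyAdapted_natural hmeas k).mono
        (Filtration.mono _ (Finset.mem_range_succ_iff.1 hk))
  · rw [Finset.sum_range_succ _ (n + 1), add_sub_cancel_left]
    filter_upwards [hX.condExp_natural_ae_eq_of_lt hmeas n.lt_succ_self] with ω hω
    rw [hω, hX₀, Pi.zero_apply]

lemma ae_exists_tendsto_sum_range (hX : iIndepFun X P) (hmeas : ∀ k, StronglyMeasurable (X k))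
    (h2 : ∀ k, MemLp (X k) 2 P) (hX₀ : ∀ k, ∫ ω, X k ω ∂P = 0)
    (hvar : Summable fun k => Var[X k; P]) :
    ∀ᵐ ω ∂P, ∃ S, Tendsto (fun n => ∑ k ∈ Finset.range n, X k ω) atTop (𝓝 S) := by
  have := hX.isProbabilityMeasure
  have hbdd : ∀ n, eLpNorm (∑ k ∈ Finset.range (n + 1), X k) 1 P ≤
      (√(∑' k, Var[X k; P])).toNNReal := fun n => by
    refine (eLpNorm_one_le_sqrt_variance (memLp_finsetSum' _ fun k _ => h2 k)
      (integral_sum_eq_zero (fun k => (h2 k).integrable one_le_two) hX₀ _)).trans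
      (ENNReal.ofReal_le_ofReal (Real.sqrt_le_sqrt ?_))
    rw [IndepFun.variance_sum (fun k _ => h2 k) fun i _ j _ hij => hX.indepFun hij]
    exact hvar.sum_le_tsum _ fun k _ => variance_nonneg _ _
  have hmart := martingale_sum_range_succ hX hmeas (fun k => (h2 k).integrable one_le_two) hX₀
  filter_upwards [hmart.submartingale.exists_ae_tendsto_of_bdd hbdd] with ω ⟨S, hS⟩
  simp only [Finset.sum_apply] at hS
  exact ⟨S, (tendsto_add_atTop_iff_nat 1).1 hS⟩

lemma le_measureReal_of_frequently_le [IsFiniteMeasure P] {f : ℕ → Ω → ℝ} {θ : ℕ → ℝ} {θ₀ p : ℝ}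
    (hf : ∀ n, AEMeasurable (f n) P)
    (hlim : ∀ᵐ ω ∂P, ∃ S, Tendsto (fun n => f n ω) atTop (𝓝 S)) (hθ : Tendsto θ atTop (𝓝 θ₀))
    (hp : ∃ᶠ n in atTop, p ≤ P.real {ω | θ n ≤ f n ω}) :
    p ≤ P.real {ω | ∃ S, Tendsto (fun n => f n ω) atTop (𝓝 S) ∧ S ≥ θ₀} := by
  set E : ℕ → Set Ω := fun N => ⋃ n ∈ Set.Ici N, {ω | θ n ≤ f n ω}
  have hE_meas : ∀ N, NullMeasurableSet (E N) P := fun N =>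
    NullMeasurableSet.biUnion (Set.to_countable _) fun n _ =>
      nullMeasurableSet_le aemeasurable_const (hf n)
  have hE_anti : Antitone E := fun M N h => Set.biUnion_subset_biUnion_left (Set.Ici_subset_Ici.2 h)
  have hE_le : ∀ N, p ≤ P.real (E N) := fun N => by
    obtain ⟨n, hn, hN⟩ := (hp.and_eventually (eventually_ge_atTop N)).exists
    exact hn.trans (measureReal_mono
      (Set.subset_biUnion_of_mem (u := fun n => {ω | θ n ≤ f n ω}) hN)
      (measure_ne_top _ _))
  have hE_lim : Tendsto (fun N => P.real (E N)) atTop (𝓝 (P.real (⋂ N, E N))) :=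
    (ENNReal.tendsto_toReal (measure_ne_top _ _)).comp
      (tendsto_measure_iInter_atTop hE_meas hE_anti ⟨0, measure_ne_top _ _⟩)
  refine (ge_of_tendsto' hE_lim hE_le).trans
    (ENNReal.toReal_mono (measure_ne_top _ _) (measure_mono_ae ?_))
  filter_upwards [hlim] with ω ⟨S, hS⟩ hω
  refine ⟨S, hS, ge_iff_le.2 (le_of_tendsto_of_tendsto_of_frequently hθ hS ?_)⟩
  refine frequently_atTop.2 fun N => ?_
  obtain ⟨n, hn, h⟩ := Set.mem_iUnion₂.1 (Set.mem_iInter.1 hω N)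
  exact ⟨n, hn, h⟩

end Convergence

/-! ### Rademacher sums -/

/-- `ε` is a family of independent Rademacher variables under `P`. The coordinates under
`rademacherSeqLaw` and the variables `t k ∘ X` of the half space depth are both of this kind. -/
structure IsRademacherFamily {ι Ω : Type*} [MeasurableSpace Ω] (ε : ι → Ω → ℝ) (P : Measure Ω) :
    Prop where
  iIndepFun : iIndepFun ε P
  hasLaw (k : ι) : HasLaw (ε k) rademacherLaw P

instance isProbabilityMeasure_rademacherSeqLaw : IsProbabilityMeasure rademacherSeqLaw :=
  inferInstanceAs (IsProbabilityMeasure (Measure.infinitePi fun _ => rademacherLaw))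

lemma isRademacherFamily_eval : IsRademacherFamily (fun k (ε : ℕ → ℝ) => ε k) rademacherSeqLaw where
  iIndepFun := iIndepFun_infinitePi fun _ => measurable_id
  hasLaw k := ⟨(measurable_pi_apply k).aemeasurable, Measure.infinitePi_map_eval _ k⟩

lemma integral_rademacherLaw (f : ℝ → ℝ) : ∫ r, f r ∂rademacherLaw = (f 1 + f (-1)) / 2 := by
  have hint : ∀ r : ℝ, Integrable f ((2⁻¹ : ℝ≥0∞) • Measure.dirac r) := fun r =>
    (integrable_dirac (by simp)).smul_measure (by simp)
  rw [rademacherLaw, integral_add_measure (hint 1) (hint (-1)), integral_smul_measure,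
    integral_smul_measure, integral_dirac, integral_dirac, ENNReal.toReal_inv,
    ENNReal.toReal_ofNat, smul_eq_mul, smul_eq_mul]
  ring

lemma ae_rademacherLaw_abs_eq_one : ∀ᵐ r ∂rademacherLaw, |r| = 1 := by
  have hmeas : MeasurableSet {r : ℝ | |r| = 1} := measurableSet_eq_fun (by fun_prop) (by fun_prop)
  rw [rademacherLaw, ae_add_measure_iff]
  constructor <;> refine Measure.ae_smul_measure ((ae_dirac_iff hmeas).2 ?_) _ <;> simp

lemma map_neg_rademacherLaw : rademacherLaw.map Neg.neg = rademacherLaw := by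
  rw [rademacherLaw, Measure.map_add _ _ measurable_neg, Measure.map_smul, Measure.map_smul,
    Measure.map_dirac' measurable_neg, Measure.map_dirac' measurable_neg, neg_neg, add_comm]

namespace IsRademacherFamily

variable {ι Ω : Type*} [MeasurableSpace Ω] {P : Measure Ω} {ε : ι → Ω → ℝ}

lemma memLp (hε : IsRademacherFamily ε P) (a : ι → ℝ) (p : ℝ≥0∞) (k : ι) :
    MemLp (fun ω => a k * ε k ω) p P := by
  have := hε.iIndepFun.isProbabilityMeasure
  refine (MemLp.of_bound (hε.hasLaw k).aemeasurable.aestronglyMeasurable 1 ?_).const_mul (a k)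
  have hone : ∀ᵐ ω ∂P, |ε k ω| = 1 :=
    ae_of_ae_map (hε.hasLaw k).aemeasurable
      ((hε.hasLaw k).map_eq.symm ▸ ae_rademacherLaw_abs_eq_one)
  filter_upwards [hone] with ω hω using hω.le

lemma integral_comp (hε : IsRademacherFamily ε P) {f : ℝ → ℝ} (hf : Measurable f) (k : ι) :
    ∫ ω, f (ε k ω) ∂P = (f 1 + f (-1)) / 2 := by
  rw [← integral_rademacherLaw]
  exact (hε.hasLaw k).integral_comp hf.aestronglyMeasurable

lemma integral_eq_zero (hε : IsRademacherFamily ε P) (a : ι → ℝ) (k : ι) :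
    ∫ ω, a k * ε k ω ∂P = 0 := by
  rw [integral_const_mul, hε.integral_comp (f := fun r => r) measurable_id]
  norm_num

lemma variance_eq (hε : IsRademacherFamily ε P) (a : ι → ℝ) (k : ι) :
    Var[fun ω => a k * ε k ω; P] = a k ^ 2 := by
  rw [variance_of_integral_eq_zero (hε.memLp a 2 k).1.aemeasurable (hε.integral_eq_zero a k)]
  simp only [mul_pow, integral_const_mul]
  rw [hε.integral_comp (f := fun r => r ^ 2) (by fun_prop)]
  norm_num

lemma integral_pow_four_eq (hε : IsRademacherFamily ε P) (a : ι → ℝ) (k : ι) :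
    ∫ ω, (a k * ε k ω) ^ 4 ∂P = a k ^ 4 := by
  simp only [mul_pow, integral_const_mul]
  rw [hε.integral_comp (f := fun r => r ^ 4) (by fun_prop)]
  norm_num

lemma identDistrib_neg (hε : IsRademacherFamily ε P) (a : ι → ℝ) (k : ι) :
    IdentDistrib (fun ω => a k * ε k ω) (-fun ω => a k * ε k ω) P P := by
  have hmeas := (hε.hasLaw k).aemeasurable
  have hmap : P.map (-ε k) = rademacherLaw :=
    calc P.map (-ε k) = (P.map (ε k)).map Neg.neg :=
          (AEMeasurable.map_map_of_aemeasurable measurable_neg.aemeasurable hmeas).symm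
      _ = rademacherLaw := by rw [(hε.hasLaw k).map_eq, map_neg_rademacherLaw]
  have h : IdentDistrib (ε k) (-ε k) P P :=
    ⟨hmeas, hmeas.neg, (hε.hasLaw k).map_eq.trans hmap.symm⟩
  simpa [Function.comp_def, Pi.neg_def] using h.comp (measurable_const_mul (a k))

lemma iIndepFun_mul (hε : IsRademacherFamily ε P) (a : ι → ℝ) :
    ProbabilityTheory.iIndepFun (fun k ω => a k * ε k ω) P :=
  hε.iIndepFun.comp (fun k r => a k * r) fun k => measurable_const_mul (a k)

lemma le_measureReal_sqrt_sum_sq_le (hε : IsRademacherFamily ε P) (a : ι → ℝ) (A : Finset ι) :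
    3 / 32 ≤ P.real {ω | √(∑ k ∈ A, a k ^ 2) / 2 ≤ ∑ k ∈ A, a k * ε k ω} := by
  -- With kurtosis bound `3` and `θ = 1 / 2` the constant is `(1 - 1 / 4) ^ 2 / (2 * 3) = 3 / 32`.
  have h := le_measureReal_mul_sqrt_sum_variance_le (hε.iIndepFun_mul a) (hε.memLp a 4)
    (hε.identDistrib_neg a) le_rfl (fun k => ?_) (θ := 1 / 2) (by norm_num) (by norm_num) A
  · simp only [hε.variance_eq, one_div_mul_eq_div] at h
    linarith
  · rw [hε.integral_pow_four_eq, hε.variance_eq]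
    linarith [pow_mul (a k) 2 2, sq_nonneg (a k ^ 2)]

lemma exp_neg_three_le_measureReal (hε : IsRademacherFamily ε P) (a : ι → ℝ) {y : ι → ℝ}
    {A : Finset ι} (hA : ∑ k ∈ A, y k ^ 2 ≤ 2) :
    Real.exp (-3) ≤ P.real {ω | (∑ k ∈ A, a k * y k) / 4 ≤ ∑ k ∈ A, a k * ε k ω} := by
  have := hε.iIndepFun.isProbabilityMeasure
  have hexp : Real.exp (-3) ≤ 3 / 32 := by
    have h : (32 / 3 : ℝ) ≤ Real.exp 1 ^ 3 := by
      calc (32 / 3 : ℝ) ≤ 2.7 ^ 3 := by norm_num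
        _ ≤ _ := by gcongr; linarith [Real.exp_one_gt_d9]
    rw [← Real.exp_nat_mul] at h
    rw [Real.exp_neg, inv_le_comm₀ (Real.exp_pos _) (by norm_num)]
    norm_num at h ⊢
    exact h
  refine (hexp.trans (hε.le_measureReal_sqrt_sum_sq_le a A)).trans (measureReal_mono fun ω hω => ?_)
  refine le_trans (b := √(∑ k ∈ A, a k ^ 2) / 2) ?_ hω
  have hy : √(∑ k ∈ A, y k ^ 2) ≤ 2 := Real.sqrt_le_iff.2 ⟨by norm_num, by linarith⟩
  calc (∑ k ∈ A, a k * y k) / 4 ≤ √(∑ k ∈ A, a k ^ 2) * √(∑ k ∈ A, y k ^ 2) / 4 := by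
        gcongr
        exact Real.sum_mul_le_sqrt_mul_sqrt A a y
    _ ≤ √(∑ k ∈ A, a k ^ 2) * 2 / 4 := by gcongr
    _ = √(∑ k ∈ A, a k ^ 2) / 2 := by ring

end IsRademacherFamily

lemma exists_subset_one_le_sum_le_two {ι : Type*} (A : Finset ι) {w : ι → ℝ}
    (hw : ∀ k, w k ≤ 1) (hA : 1 ≤ ∑ k ∈ A, w k) :
    ∃ C ⊆ A, 1 ≤ ∑ k ∈ C, w k ∧ ∑ k ∈ C, w k ≤ 2 := by
  classical
  induction A using Finset.induction_on with
  | empty => exact absurd hA (by simp)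
  | insert i A hi ih =>
    by_cases h : 1 ≤ ∑ k ∈ A, w k
    · obtain ⟨C, hCA, hC⟩ := ih h
      exact ⟨C, hCA.trans (Finset.subset_insert _ _), hC⟩
    · refine ⟨insert i A, subset_rfl, hA, ?_⟩
      rw [Finset.sum_insert hi]
      linarith [hw i]

lemma IsRademacherFamily.exp_le_measureReal {ι Ω : Type*} [MeasurableSpace Ω] {P : Measure Ω}
    {ε : ι → Ω → ℝ} (hε : IsRademacherFamily ε P) (a : ι → ℝ) {y : ι → ℝ} (hy : ∀ k, |y k| ≤ 1)
    (A : Finset ι) :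
    Real.exp (-3 * (1 + ∑ k ∈ A, y k ^ 2)) ≤
      P.real {ω | (∑ k ∈ A, a k * y k) / 4 ≤ ∑ k ∈ A, a k * ε k ω} := by
  classical
  induction A using Finset.strongInduction with | H A ih => ?_
  rcases le_or_gt (∑ k ∈ A, y k ^ 2) 2 with hA | hA
  · refine (Real.exp_le_exp.2 ?_).trans (hε.exp_neg_three_le_measureReal a hA)
    linarith [Finset.sum_nonneg fun k (_ : k ∈ A) => sq_nonneg (y k)]
  obtain ⟨C, hCA, hC₁, hC₂⟩ := exists_subset_one_le_sum_le_two A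
    (fun k => (sq_le_one_iff_abs_le_one _).2 (hy k)) (by linarith)
  have hCne : C.Nonempty := Finset.nonempty_iff_ne_empty.2 fun h => by
    rw [h, Finset.sum_empty] at hC₁
    linarith
  have hmul := measureReal_le_sum_mul_le_of_disjoint (hε.iIndepFun_mul a)
    (fun k => (hε.memLp a 1 k).1.aemeasurable) (Finset.sdiff_disjoint (s := C) (t := A))
    ((∑ k ∈ A \ C, a k * y k) / 4) ((∑ k ∈ C, a k * y k) / 4)
  rw [Finset.sdiff_union_of_subset hCA, ← add_div, Finset.sum_sdiff hCA] at hmul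
  refine le_trans ?_ hmul
  calc Real.exp (-3 * (1 + ∑ k ∈ A, y k ^ 2))
      ≤ Real.exp (-3 * (1 + ∑ k ∈ A \ C, y k ^ 2)) * Real.exp (-3) := by
        rw [← Real.exp_add, Real.exp_le_exp, ← Finset.sum_sdiff hCA]
        linarith
    _ ≤ _ := by
        gcongr
        exacts [ih _ (Finset.sdiff_ssubset hCA hCne), hε.exp_neg_three_le_measureReal a hC₂]

lemma IsRademacherFamily.exp_le_measureReal_tendsto {Ω : Type*} [MeasurableSpace Ω]
    {P : Measure Ω} {ε : ℕ → Ω → ℝ} (hε : IsRademacherFamily ε P)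
    (hmeas : ∀ k, Measurable (ε k)) (x : ℓ²(ℕ, ℝ)) {y : ℓ²(ℕ, ℝ)} (hy : ∀ k, |y k| ≤ 1) :
    Real.exp (-3 * (1 + ‖y‖ ^ 2)) ≤
      P.real {ω | ∃ S, Tendsto (fun n => ∑ k ∈ Finset.range n, x k * ε k ω) atTop (𝓝 S) ∧
        S ≥ inner ℝ x y / 4} := by
  have := hε.iIndepFun.isProbabilityMeasure
  have hmul : ∀ k, Measurable fun ω => x k * ε k ω := fun k => (hmeas k).const_mul (x k)
  have hconv := ae_exists_tendsto_sum_range (hε.iIndepFun_mul x)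
    (fun k => (hmul k).stronglyMeasurable) (hε.memLp x 2) (hε.integral_eq_zero x)
    (by simpa only [hε.variance_eq] using (hasSum_sq_lp_two x).summable)
  refine le_measureReal_of_frequently_le
    (fun n => (Finset.measurable_fun_sum _ fun k _ => hmul k).aemeasurable) hconv
    ((hasSum_mul_lp_two x y).tendsto_sum_nat.div_const 4)
    (Frequently.of_forall fun n => le_trans (Real.exp_le_exp.2 ?_)
      (hε.exp_le_measureReal x hy (Finset.range n)))
  have := sum_le_hasSum (Finset.range n) (fun k _ => sq_nonneg (y k)) (hasSum_sq_lp_two y)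
  linarith

lemma isRademacherTailConstant_twentySeven : IsRademacherTailConstant 27 := fun x s hs => by
  obtain ⟨y, hy, hys, hxy⟩ := exists_inner_eq_kFunctional hs.le x
  have hexp : (27 : ℝ)⁻¹ ≤ Real.exp (-3) := by
    rw [Real.exp_neg, inv_le_inv₀ (by norm_num) (Real.exp_pos _)]
    calc Real.exp 3 = Real.exp 1 ^ 3 := by rw [← Real.exp_nat_mul]; norm_num
      _ ≤ 3 ^ 3 := by gcongr; exact Real.exp_one_lt_three.le
      _ = 27 := by norm_num
  calc (27 : ℝ)⁻¹ * Real.exp (-27 * s ^ 2) ≤ Real.exp (-3) * Real.exp (-3 * s ^ 2) := by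
        gcongr; norm_num
    _ ≤ Real.exp (-3 * (1 + ‖y‖ ^ 2)) := by
        rw [← Real.exp_add, Real.exp_le_exp]
        have : ‖y‖ ^ 2 ≤ s ^ 2 := by gcongr
        linarith
    _ ≤ _ := isRademacherFamily_eval.exp_le_measureReal_tendsto measurable_pi_apply x hy
    _ ≤ _ := by
        refine measureReal_mono fun ε ⟨S, hS, hSx⟩ => ⟨S, hS, le_trans ?_ hSx⟩
        rw [hxy]
        linarith [kFunctional_nonneg hs.le x]

/-! ### Half-space depth -/

lemma IsRademacherTailConstant.le_measureReal_tendsto {c s : ℝ} (h : IsRademacherTailConstant c)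
    (hc : 0 < c) (hs : 0 < s) (x : ℓ²(ℕ, ℝ)) {y : ℓ²(ℕ, ℝ)} (hy_sup : ∀ k, c * |y k| ≤ 1)
    (hy_norm : c * ‖y‖ ≤ s) :
    c⁻¹ * Real.exp (-c * s ^ 2) ≤
      rademacherSeqLaw.real {ε | ∃ S, Tendsto (fun n => ∑ k ∈ Finset.range n, x k * ε k) atTop
        (𝓝 S) ∧ S ≥ inner ℝ x y} := by
  have hcy : c * inner ℝ x y ≤ kFunctional x s := by
    rw [← real_inner_smul_right]
    refine inner_le_kFunctional (fun k => ?_) ?_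
    · rw [lp.coeFn_smul, Pi.smul_apply, smul_eq_mul, abs_mul, abs_of_pos hc]
      exact hy_sup k
    · rwa [norm_smul, Real.norm_of_nonneg hc.le]
  refine (h x s hs).trans (measureReal_mono fun ε ⟨S, hS, hSx⟩ => ⟨S, hS, le_trans ?_ hSx⟩)
  rwa [le_inv_mul_iff₀ hc]

lemma hasSum_finsupp_mul {ι : Type*} (b : ι →₀ ℝ) (u : ι → ℝ) :
    HasSum (fun k => b k * u k) (b.sum fun k r => r * u k) :=
  hasSum_sum_of_ne_finset_zero fun k hk => by rw [Finsupp.notMem_support_iff.1 hk, zero_mul]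

lemma IsRademacherTailConstant.le_measureReal_finsuppSum_le {c s : ℝ}
    (h : IsRademacherTailConstant c) (hc : 0 < c) (hs : 0 < s) {y : ℓ²(ℕ, ℝ)}
    (hy_sup : ∀ k, c * |y k| ≤ 1) (hy_norm : c * ‖y‖ ≤ s) (b : ℕ →₀ ℝ) :
    c⁻¹ * Real.exp (-c * s ^ 2) ≤
      rademacherSeqLaw.real {ε | (b.sum fun k r => r * y k) ≤ b.sum fun k r => r * ε k} := by
  obtain ⟨x, hx⟩ := exists_lp_two_eq_of_summable_sq (u := b)
    (by simpa only [sq] using (hasSum_finsupp_mul b b).summable)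
  have hsum : ∀ u : ℕ → ℝ, HasSum (fun k => x k * u k) (b.sum fun k r => r * u k) := fun u => by
    simpa only [hx] using hasSum_finsupp_mul b u
  refine (h.le_measureReal_tendsto hc hs x hy_sup hy_norm).trans
    (measureReal_mono fun ε ⟨S, hS, hSx⟩ => ?_)
  rw [(hasSum_mul_lp_two x y).unique (hsum y)] at hSx
  rwa [tendsto_nhds_unique hS (hsum ε).tendsto_sum_nat] at hSx

lemma IsRademacherTailConstant.le_halfSpaceDepth {B : Type*} [MeasurableSpace B] {μ : Measure B}
    {t : ℕ → B → ℝ} {c s : ℝ} (h : IsRademacherTailConstant c) (hc : 0 < c) (hs : 0 < s)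
    (ht : HasLaw (fun x k => t k x) rademacherSeqLaw μ) {a : B} {y : ℓ²(ℕ, ℝ)}
    (hya : ∀ k, y k = t k a) (hy_sup : ∀ k, c * |y k| ≤ 1) (hy_norm : c * ‖y‖ ≤ s) :
    c⁻¹ * Real.exp (-c * s ^ 2) ≤ halfSpaceDepth (Submodule.span ℝ (Set.range t)) a μ := by
  have : Nonempty (Submodule.span ℝ (Set.range t) : Set (B → ℝ)) := ⟨0, Submodule.zero_mem _⟩
  refine le_ciInf fun ⟨g, hg⟩ => ?_
  obtain ⟨b, rfl⟩ := Finsupp.mem_span_range_iff_exists_finsupp.1 hg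
  have hmeas : MeasurableSet
      {ε : ℕ → ℝ | (b.sum fun k r => r * y k) ≤ b.sum fun k r => r * ε k} :=
    measurableSet_le measurable_const
      (Finset.measurable_fun_sum _ fun k _ => (measurable_pi_apply k).const_mul _)
  refine (h.le_measureReal_finsuppSum_le hc hs hy_sup hy_norm b).trans_eq ?_
  rw [← ht.map_eq, measureReal_def, Measure.map_apply_of_aemeasurable ht.aemeasurable hmeas]
  simp only [measureReal_def, Set.preimage, Set.mem_ofPred_eq, Finsupp.sum, Finset.sum_apply,
    Pi.smul_apply, smul_eq_mul, hya, ge_iff_le]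

lemma IsRademacherFamily.hasLaw_map {Ω B : Type*} [MeasurableSpace Ω] [MeasurableSpace B]
    {P : Measure Ω} {X : Ω → B} {t : ℕ → B → ℝ}
    (htX : IsRademacherFamily (fun k ω => t k (X ω)) P) (hX : AEMeasurable X P)
    (ht : ∀ k, AEMeasurable (t k) (P.map X)) :
    HasLaw (fun x k => t k x) rademacherSeqLaw (P.map X) := by
  have hpi := aemeasurable_pi_lambda (fun x k => t k x) ht
  refine ⟨hpi, ?_⟩
  rw [AEMeasurable.map_map_of_aemeasurable hpi hX]
  exact (htX.iIndepFun.hasLaw_infinitePi htX.hasLaw (hpi.comp_aemeasurable hX)).map_eq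

theorem proposition5_general :
    (∃ c : ℝ, 0 < c ∧ IsRademacherTailConstant c) ∧
    ∀ c : ℝ, 0 < c → IsRademacherTailConstant c →
      ∀ (B : Type*) [MeasurableSpace B] (Ω : Type*) [MeasurableSpace Ω] (P : Measure Ω)
        (X : Ω → B) (_ : AEMeasurable X P)
        (t : ℕ → B → ℝ) (_ : ∀ k, AEMeasurable (t k) (P.map X))
        (_ : iIndepFun (fun k ω => t k (X ω)) P)
        (_ : ∀ k, P.map (fun ω => t k (X ω)) = rademacherLaw)
        (a : B) (_ : Summable fun k => t k a ^ 2)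
        (t₀ : ℝ) (_ : 0 < t₀)
        (_ : max (c * ⨆ k, |t k a|) (t₀⁻¹ * c * Real.sqrt (∑' k, t k a ^ 2)) ≤ 1),
        halfSpaceDepth (Submodule.span ℝ (Set.range t) : Set (B → ℝ)) a (P.map X) ≥
          c⁻¹ * Real.exp (-c * t₀ ^ 2) := by
  refine ⟨⟨27, by norm_num, isRademacherTailConstant_twentySeven⟩, ?_⟩
  intro c hc h B _ Ω _ P X hX t ht hindep hlaw a ha t₀ ht₀ hmax
  obtain ⟨hsup, hnorm⟩ := max_le_iff.1 hmax
  obtain ⟨y, hya⟩ := exists_lp_two_eq_of_summable_sq ha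
  have htX : IsRademacherFamily (fun k ω => t k (X ω)) P :=
    ⟨hindep, fun k => ⟨(ht k).comp_aemeasurable hX, hlaw k⟩⟩
  simp only [← hya] at hsup hnorm
  refine h.le_halfSpaceDepth hc ht₀ (htX.hasLaw_map hX ht) hya (fun k => ?_) ?_
  · exact (mul_le_mul_of_nonneg_left (le_ciSup (bddAbove_range_abs_lp_two y) k) hc.le).trans hsup
  · rwa [mul_assoc, inv_mul_le_iff₀ ht₀, mul_one, ← norm_lp_two_eq_sqrt_tsum] at hnorm

theorem proposition5 :
    (∃ c : ℝ, 0 < c ∧ IsRademacherTailConstant c) ∧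
    ∀ c : ℝ, 0 < c → IsRademacherTailConstant c →
      ∀ (B : Type*) [AddCommGroup B] [Module ℝ B] [MetricSpace B] [IsTopologicalAddGroup B]
        [ContinuousSMul ℝ B] [CompleteSpace B] [TopologicalSpace.SeparableSpace B]
        [MeasurableSpace B] [BorelSpace B]
        (_ : ∀ x y z : B, dist (x + z) (y + z) = dist x y)
        (Ω : Type*) [MeasurableSpace Ω] (P : Measure Ω) [IsProbabilityMeasure P]
        (X : Ω → B) (_ : Measurable X)
        (t : ℕ → B → ℝ) (_ : ∀ k, Measurable (t k))
        (_ : iIndepFun (fun k ω => t k (X ω)) P)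
        (_ : ∀ k, P.map (fun ω => t k (X ω)) = rademacherLaw)
        (a : B) (_ : Summable fun k => t k a ^ 2)
        (t₀ : ℝ) (_ : 0 < t₀)
        (_ : max (c * ⨆ k, |t k a|) (t₀⁻¹ * c * Real.sqrt (∑' k, t k a ^ 2)) ≤ 1),
        halfSpaceDepth (Submodule.span ℝ (Set.range t) : Set (B → ℝ)) a (P.map X) ≥
          c⁻¹ * Real.exp (-c * t₀ ^ 2) :=
  proposition5_general.imp_right fun h c hc hctail B _ _ _ _ _ _ _ _ _ _ Ω _ P _ X hX t ht =>
    h c hc hctail B Ω P X hX.aemeasurable t fun k => (ht k).aemeasurable
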